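/- For every $\delta\in(0,1)$ and $\varepsilon_0\in(0,1)$ there is a constant $D>0$, depending only on $\delta$ and $\varepsilon_0$, such that the following holds. Let $X\in\mathbb{R}^{n\times d}$ have rank $\rho$, let $U\in\mathbb{R}^{n\times\rho}$ be any matrix whose columns form an orthonormal basis of the column space of $X$, and let $l_i=\|U_{i*}\|^2/\|U\|_F^2$, $i=1,\dots,n$, be the leverage scores (read as $0$ if $\rho=0$). Let $0<\varepsilon<1$, where $\varepsilon\le\varepsilon_0$ in case $\rho=1$, and let $k$ be any real number with $$k\;\ge\; D\,\frac{\rho\log(\rho/\varepsilon)}{\varepsilon^2}$$ (for $\rho=0$ the right-hand side is read as $0$); in particular $k$ may be chosen equal to the right-hand side, so that $k=O(\rho\log(\rho/\varepsilon)/\varepsilon^2)$. Put $q_i=\min\{1,k\,l_i\}$, and let $S\in\mathbb{R}^{n\times n}$ be the random diagonal matrix with independent diagonal entries such that $S_{ii}=1/\sqrt{q_i}$ with probability $q_i$ and $S_{ii}=0$ otherwise. Then, with probability at least $1-\delta$, the matrix $S$ is an $\varepsilon$-subspace embedding for the column space of $X$, that is, $$(1-\varepsilon)\|X\gamma\|^2\le\|SX\gamma\|^2\le(1+\varepsilon)\|X\gamma\|^2\qquad\text{for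 all }\gamma\in\mathbb{R}^d .$$ Here $\|\cdot\|$ is the Euclidean norm and $\|\cdot\|_F$ the Frobenius norm. -/

import Mathlib

/-!
In the coordinates given by `U` the sampling error is `A = ∑ i, tᵢ uᵢ uᵢᵀ`, where `uᵢ` are the rows
of `U` and the weights `tᵢ = Sᵢᵢ² - 1` are independent and centred (at `qᵢ > 0`), and the task is to
bound `A` by `ε` in operator norm. This goes by the moments `E tr A^{2p}`. Write
`tr A^{m+2} = ∑ i, tᵢ ⟨uᵢ, A^{m+1} uᵢ⟩` and exchange `tᵢ` with an independent copy `c`. As `tᵢ` is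
centred, the expectation of a summand is half that of `(tᵢ - c) ⟨uᵢ, (A^{m+1} - B^{m+1}) uᵢ⟩`, where
`B` has `c` in place of `tᵢ`. As `A - B = (tᵢ - c) uᵢ uᵢᵀ`, this is `(tᵢ - c)²` times the sum of
`⟨uᵢ, A^j uᵢ⟩ ⟨uᵢ, B^l uᵢ⟩` over `j + l = m`, and on pairs of eigenvalues the inequality
`x^j y^l + x^l y^j ≤ x^m + y^m` (`m` even) bounds that sum by
`(m + 1) / 2 * ‖uᵢ‖² * (⟨uᵢ, A^m uᵢ⟩ + ⟨uᵢ, B^m uᵢ⟩)`. For `qᵢ = min {1, k ‖uᵢ‖² / ρ}` the mean of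
`(tᵢ - c)² ‖uᵢ‖²` over `c` is at most `(ρ / k) (tᵢ + 2)`, so the factor `tᵢ` comes back and the sum
over `i` is again a combination of traces: `E tr A^{2s+2} ≤ 5 (s + 1) (ρ / k) E tr A^{2s}`. Markov's
inequality with `p ≈ log (ρ / δ)` concludes.
-/

open MeasureTheory

noncomputable section

namespace LeverageSampling

/-- `S` is an `ε`-subspace embedding for the column space of `X`
(the norms are Euclidean). -/
def IsSubspaceEmbedding {m n d : ℕ} (ε : ℝ) (X : Matrix (Fin n) (Fin d) ℝ)
    (S : Matrix (Fin m) (Fin n) ℝ) : Prop :=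
  ∀ γ : Fin d → ℝ,
    (1 - ε) * ‖WithLp.toLp 2 (X.mulVec γ)‖ ^ 2 ≤ ‖WithLp.toLp 2 ((S * X).mulVec γ)‖ ^ 2 ∧
    ‖WithLp.toLp 2 ((S * X).mulVec γ)‖ ^ 2 ≤ (1 + ε) * ‖WithLp.toLp 2 (X.mulVec γ)‖ ^ 2

/-- The columns of `U` form an orthonormal basis of the column space of `X`. -/
def IsOrthonormalColBasis {n d r : ℕ} (X : Matrix (Fin n) (Fin d) ℝ)
    (U : Matrix (Fin n) (Fin r) ℝ) : Prop :=
  Orthonormal ℝ (fun j : Fin r => WithLp.toLp 2 (U.col j)) ∧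
    Submodule.span ℝ (Set.range U.col) = Submodule.span ℝ (Set.range X.col)

/-- The leverage score `l_i = ‖U_{i*}‖² / ‖U‖_F²`; the squared Frobenius norm is the sum of the
squared row norms. -/
def leverageScore {n r : ℕ} (U : Matrix (Fin n) (Fin r) ℝ) (i : Fin n) : ℝ :=
  ‖WithLp.toLp 2 (U.row i)‖ ^ 2 / ∑ i', ‖WithLp.toLp 2 (U.row i')‖ ^ 2

/-- The sampling probability `q_i = min {1, k l_i}`. -/
def samplingProb {n r : ℕ} (U : Matrix (Fin n) (Fin r) ℝ) (k : ℝ) (i : Fin n) : ℝ :=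
  min 1 (k * leverageScore U i)

/-- The law of one diagonal entry: `1 / √q` with probability `q`, and `0` otherwise. -/
def entryLaw (q : ℝ) : Measure ℝ :=
  ENNReal.ofReal q • Measure.dirac (1 / √q) + ENNReal.ofReal (1 - q) • Measure.dirac 0

/-- The joint law of the diagonal `(S_{11}, …, S_{nn})` of the sampling matrix: the entries are
independent, the `i`-th one with law `entryLaw (q i)`. -/
def diagLaw {n : ℕ} (q : Fin n → ℝ) : Measure (Fin n → ℝ) :=
  Measure.pi fun i => entryLaw (q i)

end LeverageSampling

end

open Matrix Finset

namespace LeverageSampling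

section PowerDifference

theorem pow_succ_sub_pow_succ_eq_sum_antidiagonal {R : Type*} [Ring R] (a b : R) (m : ℕ) :
    a ^ (m + 1) - b ^ (m + 1) = ∑ p ∈ antidiagonal m, a ^ p.1 * (a - b) * b ^ p.2 := by
  induction m with
  | zero => simp
  | succ m ih =>
    have hshift : ∑ p ∈ antidiagonal m, a ^ p.1 * (a - b) * b ^ (p.2 + 1) =
        (a ^ (m + 1) - b ^ (m + 1)) * b := by
      rw [ih, sum_mul]
      exact sum_congr rfl fun p _ => by rw [pow_succ, ← mul_assoc]
    rw [Finset.Nat.sum_antidiagonal_succ', hshift]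
    simp only [pow_succ _ (m + 1)]
    noncomm_ring

variable {R : Type*} [CommRing R] [LinearOrder R] [IsStrictOrderedRing R]

theorem pow_mul_pow_add_pow_mul_pow_le (x y : R) {i j : ℕ} (h : Even (i + j)) :
    x ^ i * y ^ j + x ^ j * y ^ i ≤ x ^ (i + j) + y ^ (i + j) := by
  have hmono (k : ℕ) : Monotone fun z : {z : R // 0 ≤ z} => (z : R) ^ k :=
    fun a b hab => pow_le_pow_left₀ a.2 hab k
  have hprod : 0 ≤ (|x| ^ i - |y| ^ i) * (|x| ^ j - |y| ^ j) :=
    ((hmono i).monovary (hmono j)).sub_mul_sub_nonneg ⟨|y|, abs_nonneg y⟩ ⟨|x|, abs_nonneg x⟩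
  have hle (a b : R) (k l : ℕ) : a ^ k * b ^ l ≤ |a| ^ k * |b| ^ l := by
    simpa only [abs_mul, abs_pow] using le_abs_self (a ^ k * b ^ l)
  have habs (z : R) : |z| ^ i * |z| ^ j = z ^ (i + j) := by rw [← pow_add, h.pow_abs]
  linarith [hle x y i j, hle x y j i, habs x, habs y]

theorem two_mul_sum_antidiagonal_pow_mul_pow_le (x y : R) {m : ℕ} (hm : Even m) :
    2 * ∑ p ∈ antidiagonal m, x ^ p.1 * y ^ p.2 ≤ (m + 1) * (x ^ m + y ^ m) := by
  calc 2 * ∑ p ∈ antidiagonal m, x ^ p.1 * y ^ p.2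
      = ∑ p ∈ antidiagonal m, (x ^ p.1 * y ^ p.2 + x ^ p.2 * y ^ p.1) := by
        rw [sum_add_distrib, two_mul]
        congr 1
        exact (Finset.Nat.sum_antidiagonal_swap (f := fun p => x ^ p.1 * y ^ p.2)).symm
    _ ≤ ∑ _p ∈ antidiagonal m, (x ^ m + y ^ m) := sum_le_sum fun p hp => by
        obtain rfl := mem_antidiagonal.1 hp
        exact pow_mul_pow_add_pow_mul_pow_le x y hm
    _ = (m + 1) * (x ^ m + y ^ m) := by
        rw [sum_const, Finset.Nat.card_antidiagonal, nsmul_eq_mul, Nat.cast_succ]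

end PowerDifference

section Spectral

variable {r : Type*} [Fintype r] [DecidableEq r] {A B : Matrix r r ℝ}

theorem pow_eq_eigenvectorUnitary_mul_diagonal_mul (hA : A.IsHermitian) (m : ℕ) :
    A ^ m = (hA.eigenvectorUnitary : Matrix r r ℝ) * diagonal (hA.eigenvalues ^ m) *
      (hA.eigenvectorUnitary : Matrix r r ℝ)ᵀ := by
  conv_lhs => rw [hA.spectral_theorem, ← map_pow, diagonal_pow, Unitary.conjStarAlgAut_apply]
  rfl

theorem trace_pow_eq_sum_eigenvalues_pow (hA : A.IsHermitian) (m : ℕ) :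
    (A ^ m).trace = ∑ x, hA.eigenvalues x ^ m := by
  have hU : (hA.eigenvectorUnitary : Matrix r r ℝ)ᵀ * (hA.eigenvectorUnitary : Matrix r r ℝ) = 1 :=
    Unitary.star_mul_self_of_mem hA.eigenvectorUnitary.2
  rw [pow_eq_eigenvectorUnitary_mul_diagonal_mul hA, trace_mul_cycle, hU, one_mul, trace_diagonal]
  rfl

/-- The mass at the eigenvalue `hA.eigenvalues x` of the spectral measure of `A` at the
vector `u`; repeated eigenvalues are kept apart. -/
noncomputable def spectralWeight (hA : A.IsHermitian) (u : r → ℝ) (x : r) : ℝ :=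
  ((hA.eigenvectorUnitary : Matrix r r ℝ)ᵀ *ᵥ u) x ^ 2

theorem spectralWeight_nonneg (hA : A.IsHermitian) (u : r → ℝ) (x : r) :
    0 ≤ spectralWeight hA u x :=
  sq_nonneg _

theorem dotProduct_pow_mulVec_eq_sum (hA : A.IsHermitian) (u : r → ℝ) (m : ℕ) :
    u ⬝ᵥ (A ^ m *ᵥ u) = ∑ x, spectralWeight hA u x * hA.eigenvalues x ^ m := by
  rw [pow_eq_eigenvectorUnitary_mul_diagonal_mul hA, ← mulVec_mulVec, ← mulVec_mulVec,
    dotProduct_mulVec, ← mulVec_transpose]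
  simp only [dotProduct, mulVec_diagonal, spectralWeight, Pi.pow_apply]
  exact sum_congr rfl fun x _ => by ring

theorem dotProduct_self_eq_sum_spectralWeight (hA : A.IsHermitian) (u : r → ℝ) :
    u ⬝ᵥ u = ∑ x, spectralWeight hA u x := by
  simpa using dotProduct_pow_mulVec_eq_sum hA u 0

theorem dotProduct_even_pow_mulVec_nonneg (hA : A.IsHermitian) (u : r → ℝ) {m : ℕ}
    (hm : Even m) : 0 ≤ u ⬝ᵥ (A ^ m *ᵥ u) := by
  rw [dotProduct_pow_mulVec_eq_sum hA]
  exact sum_nonneg fun x _ => mul_nonneg (spectralWeight_nonneg hA u x) (hm.pow_nonneg _)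

theorem trace_even_pow_nonneg (hA : A.IsHermitian) {m : ℕ} (hm : Even m) : 0 ≤ (A ^ m).trace := by
  rw [trace_pow_eq_sum_eigenvalues_pow hA]
  exact sum_nonneg fun x _ => hm.pow_nonneg _

theorem two_mul_trace_pow_succ_le (hA : A.IsHermitian) {m : ℕ} (hm : Even m) :
    2 * (A ^ (m + 1)).trace ≤ (A ^ (m + 2)).trace + (A ^ m).trace := by
  simp only [trace_pow_eq_sum_eigenvalues_pow hA, ← sum_add_distrib, mul_sum]
  refine sum_le_sum fun x _ => ?_
  have hsq := mul_nonneg (hm.pow_nonneg (hA.eigenvalues x)) (sq_nonneg (hA.eigenvalues x - 1))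
  linear_combination hsq

theorem abs_dotProduct_mulVec_le_of_trace_pow_le (hA : A.IsHermitian) {p : ℕ} (hp : p ≠ 0)
    {ε : ℝ} (hε : 0 ≤ ε) (h : (A ^ (2 * p)).trace ≤ ε ^ (2 * p)) (v : r → ℝ) :
    |v ⬝ᵥ (A *ᵥ v)| ≤ ε * (v ⬝ᵥ v) := by
  have hev : Even (2 * p) := even_two_mul p
  have heig (x : r) : |hA.eigenvalues x| ≤ ε := by
    refine le_of_pow_le_pow_left₀ (mul_ne_zero two_ne_zero hp) hε ?_
    calc |hA.eigenvalues x| ^ (2 * p) = hA.eigenvalues x ^ (2 * p) := hev.pow_abs _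
      _ ≤ ∑ y, hA.eigenvalues y ^ (2 * p) :=
        single_le_sum (f := fun y => hA.eigenvalues y ^ (2 * p)) (fun y _ => hev.pow_nonneg _)
          (mem_univ x)
      _ ≤ ε ^ (2 * p) := by rwa [← trace_pow_eq_sum_eigenvalues_pow hA]
  calc |v ⬝ᵥ (A *ᵥ v)| = |∑ x, spectralWeight hA v x * hA.eigenvalues x| := by
        simpa using congrArg abs (dotProduct_pow_mulVec_eq_sum hA v 1)
    _ ≤ ∑ x, |spectralWeight hA v x * hA.eigenvalues x| := abs_sum_le_sum_abs _ _
    _ ≤ ∑ x, ε * spectralWeight hA v x := sum_le_sum fun x _ => by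
        rw [abs_mul, abs_of_nonneg (spectralWeight_nonneg hA v x), mul_comm]
        exact mul_le_mul_of_nonneg_right (heig x) (spectralWeight_nonneg hA v x)
    _ = ε * (v ⬝ᵥ v) := by rw [← mul_sum, dotProduct_self_eq_sum_spectralWeight hA]

theorem two_mul_sum_antidiagonal_moment_mul_moment_le (hA : A.IsHermitian) (hB : B.IsHermitian)
    (u : r → ℝ) {m : ℕ} (hm : Even m) :
    2 * ∑ p ∈ antidiagonal m, (u ⬝ᵥ (A ^ p.1 *ᵥ u)) * (u ⬝ᵥ (B ^ p.2 *ᵥ u)) ≤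
      (m + 1) * (u ⬝ᵥ u) * (u ⬝ᵥ (A ^ m *ᵥ u) + u ⬝ᵥ (B ^ m *ᵥ u)) := by
  set c := spectralWeight hA u
  set c' := spectralWeight hB u
  set l := hA.eigenvalues
  set l' := hB.eigenvalues
  have hmA : ∀ j, u ⬝ᵥ (A ^ j *ᵥ u) = ∑ x, c x * l x ^ j := dotProduct_pow_mulVec_eq_sum hA u
  have hmB : ∀ j, u ⬝ᵥ (B ^ j *ᵥ u) = ∑ y, c' y * l' y ^ j := dotProduct_pow_mulVec_eq_sum hB u
  calc 2 * ∑ p ∈ antidiagonal m, (u ⬝ᵥ (A ^ p.1 *ᵥ u)) * (u ⬝ᵥ (B ^ p.2 *ᵥ u))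
      = ∑ x, ∑ y, c x * c' y * (2 * ∑ p ∈ antidiagonal m, l x ^ p.1 * l' y ^ p.2) := by
        simp only [hmA, hmB, sum_mul_sum]
        simp only [mul_sum]
        rw [sum_comm]
        refine sum_congr rfl fun x _ => ?_
        rw [sum_comm]
        exact sum_congr rfl fun y _ => sum_congr rfl fun p _ => by ring
    _ ≤ ∑ x, ∑ y, c x * c' y * ((m + 1) * (l x ^ m + l' y ^ m)) :=
        sum_le_sum fun x _ => sum_le_sum fun y _ => mul_le_mul_of_nonneg_left
          (two_mul_sum_antidiagonal_pow_mul_pow_le _ _ hm)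
          (mul_nonneg (spectralWeight_nonneg hA u x) (spectralWeight_nonneg hB u y))
    _ = (m + 1) * ((∑ x, c x * l x ^ m) * (∑ y, c' y) + (∑ x, c x) * ∑ y, c' y * l' y ^ m) := by
        simp only [sum_mul_sum, ← sum_add_distrib]
        simp only [mul_sum]
        exact sum_congr rfl fun x _ => sum_congr rfl fun y _ => by ring
    _ = (m + 1) * (u ⬝ᵥ u) * (u ⬝ᵥ (A ^ m *ᵥ u) + u ⬝ᵥ (B ^ m *ᵥ u)) := by
        rw [hmA, hmB, ← dotProduct_self_eq_sum_spectralWeight hA,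
          ← dotProduct_self_eq_sum_spectralWeight hB]
        ring

theorem dotProduct_pow_succ_mulVec_sub {u : r → ℝ} {t : ℝ}
    (hAB : A - B = t • vecMulVec u u) (m : ℕ) :
    u ⬝ᵥ (A ^ (m + 1) *ᵥ u) - u ⬝ᵥ (B ^ (m + 1) *ᵥ u) =
      t * ∑ p ∈ antidiagonal m, (u ⬝ᵥ (A ^ p.1 *ᵥ u)) * (u ⬝ᵥ (B ^ p.2 *ᵥ u)) := by
  rw [← dotProduct_sub, ← sub_mulVec, pow_succ_sub_pow_succ_eq_sum_antidiagonal, sum_mulVec,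
    dotProduct_sum, mul_sum]
  refine sum_congr rfl fun p _ => ?_
  rw [hAB, ← mulVec_mulVec, ← mulVec_mulVec, smul_mulVec, vecMulVec_mulVec]
  simp only [mulVec_smul, dotProduct_smul, smul_eq_mul, op_smul_eq_smul]
  ring

theorem mul_dotProduct_pow_succ_mulVec_sub_le (hA : A.IsHermitian) (hB : B.IsHermitian)
    {u : r → ℝ} {t : ℝ} (hAB : A - B = t • vecMulVec u u) {m : ℕ} (hm : Even m) :
    t * (u ⬝ᵥ (A ^ (m + 1) *ᵥ u) - u ⬝ᵥ (B ^ (m + 1) *ᵥ u)) ≤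
      t ^ 2 * ((m + 1) / 2 * (u ⬝ᵥ u) * (u ⬝ᵥ (A ^ m *ᵥ u)) +
        (m + 1) / 2 * (u ⬝ᵥ u) * (u ⬝ᵥ (B ^ m *ᵥ u))) := by
  rw [dotProduct_pow_succ_mulVec_sub hAB, ← mul_assoc, ← sq]
  refine mul_le_mul_of_nonneg_left ?_ (sq_nonneg t)
  linear_combination (two_mul_sum_antidiagonal_moment_mul_moment_le hA hB u hm) / 2

end Spectral

section WeightedGram

variable {ι r : Type*} [Fintype ι]

/-- The Gram matrix of the rows of `U` with weights `t`, that is, `Uᵀ diag(t) U`. The sampled matrix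
`(S U)ᵀ (S U)` differs from the identity by such a matrix with independent centred weights. -/
noncomputable def weightedGram (U : Matrix ι r ℝ) (t : ι → ℝ) : Matrix r r ℝ :=
  ∑ i, t i • vecMulVec (U.row i) (U.row i)

theorem weightedGram_one (U : Matrix ι r ℝ) : weightedGram U 1 = Uᵀ * U := by
  ext j k
  simp only [weightedGram, Pi.one_apply, one_smul, Matrix.sum_apply, vecMulVec_apply, mul_apply,
    transpose_apply, row_apply]

theorem isHermitian_weightedGram (U : Matrix ι r ℝ) (t : ι → ℝ) :
    (weightedGram U t).IsHermitian := by
  refine isSelfAdjoint_sum _ fun i _ => IsSelfAdjoint.smul (.all _) ?_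
  ext j k
  exact mul_comm _ _

theorem continuous_weightedGram (U : Matrix ι r ℝ) : Continuous (weightedGram U) := by
  unfold weightedGram
  fun_prop

theorem weightedGram_sub_update [DecidableEq ι] (U : Matrix ι r ℝ) (t : ι → ℝ) (i : ι) (c : ℝ) :
    weightedGram U t - weightedGram U (Function.update t i c) =
      (t i - c) • vecMulVec (U.row i) (U.row i) := by
  simp only [weightedGram, ← sum_sub_distrib, ← sub_smul]
  rw [sum_eq_single i (fun j _ hj => by simp [hj]) (by simp), Function.update_self]

variable [Fintype r]

theorem trace_weightedGram_mul (U : Matrix ι r ℝ) (t : ι → ℝ) (A : Matrix r r ℝ) :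
    (weightedGram U t * A).trace = ∑ i, t i * (U.row i ⬝ᵥ (A *ᵥ U.row i)) := by
  rw [weightedGram, sum_mul, trace_sum]
  refine sum_congr rfl fun i _ => ?_
  rw [smul_mul, trace_smul, smul_eq_mul, vecMulVec_mul, trace_vecMulVec, dotProduct_mulVec,
    dotProduct_comm]

theorem dotProduct_weightedGram_mulVec (U : Matrix ι r ℝ) (t : ι → ℝ) (v : r → ℝ) :
    v ⬝ᵥ (weightedGram U t *ᵥ v) = ∑ i, t i * (U *ᵥ v) i ^ 2 := by
  rw [weightedGram, sum_mulVec, dotProduct_sum]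
  refine sum_congr rfl fun i _ => ?_
  rw [smul_mulVec, vecMulVec_mulVec, dotProduct_smul, op_smul_eq_smul, dotProduct_smul,
    dotProduct_comm v, smul_eq_mul, smul_eq_mul, sq]
  rfl

theorem sum_dotProduct_mulVec_eq_trace [DecidableEq r] {U : Matrix ι r ℝ} (hU : Uᵀ * U = 1)
    (A : Matrix r r ℝ) : ∑ i, U.row i ⬝ᵥ (A *ᵥ U.row i) = A.trace := by
  have h := trace_weightedGram_mul U 1 A
  simp only [weightedGram_one, hU, one_mul, Pi.one_apply] at h
  exact h.symm

end WeightedGram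

section Resampling

variable {ι : Type*} [Fintype ι]

theorem measurePreserving_update_prod [DecidableEq ι] {α : ι → Type*} [∀ i, MeasurableSpace (α i)]
    (ν : ∀ i, Measure (α i)) [∀ i, SigmaFinite (ν i)] (i : ι) :
    MeasurePreserving (fun z : (∀ j, α j) × α i => (Function.update z.1 i z.2, z.1 i))
      ((Measure.pi ν).prod (ν i)) ((Measure.pi ν).prod (ν i)) := by
  have hmeas : Measurable fun z : (∀ j, α j) × α i => (Function.update z.1 i z.2, z.1 i) :=
    (measurable_update'.comp measurable_id).prodMk ((measurable_pi_apply i).comp measurable_fst)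
  refine ⟨hmeas, (Measure.prod_eq_generateFrom generateFrom_pi
    MeasurableSpace.generateFrom_measurableSet
    isPiSystem_pi MeasurableSpace.isPiSystem_measurableSet
    (Measure.FiniteSpanningSetsIn.pi fun j => (ν j).toFiniteSpanningSetsIn)
    (ν i).toFiniteSpanningSetsIn ?_).symm⟩
  rintro _ ⟨s, hs, rfl⟩ B hB
  have hpre : (fun z : (∀ j, α j) × α i => (Function.update z.1 i z.2, z.1 i)) ⁻¹'
      (Set.univ.pi s ×ˢ B) = Set.univ.pi (Function.update s i B) ×ˢ s i := by
    ext z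
    simp only [Set.mem_preimage, Set.mem_prod, Set.mem_univ_pi]
    rw [Function.forall_update_iff z.1 (p := fun j a => a ∈ s j),
      Function.forall_update_iff s (p := fun j S => z.1 j ∈ S)]
    tauto
  rw [Measure.map_apply hmeas ((MeasurableSet.univ_pi fun j => hs j trivial).prod hB), hpre,
    Measure.prod_prod, Measure.pi_pi, Measure.pi_pi, ← mul_prod_erase univ _ (mem_univ i),
    ← mul_prod_erase univ (fun j => ν j (s j)) (mem_univ i), Function.update_self,
    prod_congr rfl fun j hj => by rw [Function.update_of_ne (ne_of_mem_erase hj)]]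
  ring

theorem integrable_of_continuous_of_ae_mem_isCompact {X E : Type*} [TopologicalSpace X]
    [MeasurableSpace X] [OpensMeasurableSpace X] [T2Space X] [NormedAddCommGroup E]
    {μ : Measure X} [IsFiniteMeasureOnCompacts μ] {K : Set X}
    (hK : IsCompact K) (hμ : ∀ᵐ x ∂μ, x ∈ K) {f : X → E} (hf : Continuous f) : Integrable f μ := by
  rw [← Measure.restrict_eq_self_of_ae_mem hμ]
  exact hf.continuousOn.integrableOn_compact hK

theorem integral_le_integral_of_add_comp_le {X : Type*} [MeasurableSpace X] {μ : Measure X}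
    {T : X → X} (hT : MeasurePreserving T μ μ) {F H : X → ℝ} (hF : Integrable F μ)
    (hH : Integrable H μ) (h : ∀ x, F x + F (T x) ≤ H x + H (T x)) :
    ∫ x, F x ∂μ ≤ ∫ x, H x ∂μ := by
  have hcomp {G : X → ℝ} (hG : Integrable G μ) : Integrable (fun x => G (T x)) μ :=
    hT.integrable_comp_of_integrable hG
  have hdouble {G : X → ℝ} (hG : Integrable G μ) :
      ∫ x, (G x + G (T x)) ∂μ = 2 * ∫ x, G x ∂μ := by
    have hG' : AEStronglyMeasurable G (μ.map T) := hT.map_eq.symm ▸ hG.aestronglyMeasurable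
    rw [integral_add hG (hcomp hG), ← integral_map hT.aemeasurable hG', hT.map_eq, two_mul]
  have hle := integral_mono (hF.add (hcomp hF)) (hH.add (hcomp hH)) h
  simp only [Pi.add_apply, hdouble hF, hdouble hH] at hle
  linarith

variable {ν : ι → Measure ℝ} [∀ i, IsProbabilityMeasure (ν i)]

theorem integrable_pi_of_continuous (hν : ∀ i, ∃ K, IsCompact K ∧ ∀ᵐ x ∂ν i, x ∈ K)
    {f : (ι → ℝ) → ℝ} (hf : Continuous f) : Integrable f (Measure.pi ν) := by
  choose K hK hν using hν
  refine integrable_of_continuous_of_ae_mem_isCompact (isCompact_univ_pi hK) ?_ hf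
  simp only [Set.mem_univ_pi]
  exact ae_all_iff.2 fun i => Measure.tendsto_eval_ae_ae.eventually (hν i)

theorem integrable_pi_prod_of_continuous (hν : ∀ i, ∃ K, IsCompact K ∧ ∀ᵐ x ∂ν i, x ∈ K) (i : ι)
    {F : (ι → ℝ) × ℝ → ℝ} (hF : Continuous F) : Integrable F ((Measure.pi ν).prod (ν i)) := by
  choose K hK hν using hν
  refine integrable_of_continuous_of_ae_mem_isCompact ((isCompact_univ_pi hK).prod (hK i)) ?_ hF
  filter_upwards [Measure.quasiMeasurePreserving_fst.ae (ae_all_iff.2 fun j =>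
      Measure.tendsto_eval_ae_ae.eventually (hν j)),
    Measure.quasiMeasurePreserving_snd.ae (hν i)] with z hfst hsnd
  exact ⟨fun j _ => hfst j, hsnd⟩

theorem integrable_integral_sub_sq_mul (hν : ∀ i, ∃ K, IsCompact K ∧ ∀ᵐ x ∂ν i, x ∈ K) (i : ι)
    {g : (ι → ℝ) → ℝ} (hg : Continuous g) :
    Integrable (fun t => (∫ c, (t i - c) ^ 2 ∂ν i) * g t) (Measure.pi ν) := by
  have hprod := integrable_pi_prod_of_continuous hν i
    (F := fun z => (z.1 i - z.2) ^ 2 * g z.1) (by fun_prop)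
  simpa only [integral_mul_const] using hprod.integral_prod_left

theorem integral_mul_le_integral_sub_sq_mul [DecidableEq ι]
    (hν : ∀ i, ∃ K, IsCompact K ∧ ∀ᵐ x ∂ν i, x ∈ K) {i : ι} (hmean : ∫ x, x ∂ν i = 0)
    {f g : (ι → ℝ) → ℝ} (hf : Continuous f) (hg : Continuous g)
    (hfg : ∀ t c, (t i - c) * (f t - f (Function.update t i c)) ≤
      (t i - c) ^ 2 * (g t + g (Function.update t i c))) :
    ∫ t, t i * f t ∂Measure.pi ν ≤ ∫ t, (∫ c, (t i - c) ^ 2 ∂ν i) * g t ∂Measure.pi ν := by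
  have hF : Integrable (fun z : (ι → ℝ) × ℝ => (z.1 i - z.2) * f z.1)
      ((Measure.pi ν).prod (ν i)) :=
    integrable_pi_prod_of_continuous hν i (by fun_prop)
  have hH : Integrable (fun z : (ι → ℝ) × ℝ => (z.1 i - z.2) ^ 2 * g z.1)
      ((Measure.pi ν).prod (ν i)) :=
    integrable_pi_prod_of_continuous hν i (by fun_prop)
  obtain ⟨K, hK, hKν⟩ := hν i
  have hid : Integrable (fun c : ℝ => c) (ν i) :=
    integrable_of_continuous_of_ae_mem_isCompact hK hKν continuous_id
  have hcenter (x : ℝ) : ∫ c, (x - c) ∂ν i = x := by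
    rw [integral_sub (integrable_const x) hid, hmean, integral_const, probReal_univ, one_smul,
      sub_zero]
  have hle := integral_le_integral_of_add_comp_le (measurePreserving_update_prod ν i) hF hH
    fun ⟨t, c⟩ => by
      simp only [Function.update_self]
      linear_combination hfg t c
  rw [integral_prod _ hF, integral_prod _ hH] at hle
  simpa only [integral_mul_const, hcenter] using hle

end Resampling

section Moments

variable {ι r : Type*} [Fintype ι] [Fintype r]

/-- Laws of independent weights for the rows of `U` that are compactly supported and, at every
nonzero row, centred and such that resampling the weight `x` moves it by at most
`τ (x + 2) / ‖U.row i‖²` in mean square. Zero rows do not contribute to `weightedGram U`. -/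
structure IsResamplingBounded (U : Matrix ι r ℝ) (ν : ι → Measure ℝ) (τ : ℝ) : Prop where
  exists_isCompact (i : ι) : ∃ K, IsCompact K ∧ ∀ᵐ x ∂ν i, x ∈ K
  integral_eq_zero (i : ι) : U.row i ≠ 0 → ∫ x, x ∂ν i = 0
  ae_integral_sub_sq_mul_le (i : ι) : U.row i ≠ 0 →
    ∀ᵐ x ∂ν i, (∫ c, (x - c) ^ 2 ∂ν i) * (U.row i ⬝ᵥ U.row i) ≤ τ * (x + 2)

variable {U : Matrix ι r ℝ} {ν : ι → Measure ℝ} [∀ i, IsProbabilityMeasure (ν i)] {τ : ℝ}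

theorem IsResamplingBounded.integrable_of_continuous (h : IsResamplingBounded U ν τ)
    {f : (ι → ℝ) → ℝ} (hf : Continuous f) : Integrable f (Measure.pi ν) :=
  integrable_pi_of_continuous h.exists_isCompact hf

variable [DecidableEq r]

theorem continuous_dotProduct_weightedGram_pow_mulVec (U : Matrix ι r ℝ) (m : ℕ) (u : r → ℝ) :
    Continuous fun t => u ⬝ᵥ (weightedGram U t ^ m *ᵥ u) :=
  continuous_const.dotProduct (((continuous_weightedGram U).pow m).matrix_mulVec continuous_const)

theorem continuous_trace_weightedGram_pow (U : Matrix ι r ℝ) (m : ℕ) :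
    Continuous fun t => (weightedGram U t ^ m).trace :=
  ((continuous_weightedGram U).pow m).matrix_trace

theorem IsResamplingBounded.integral_mul_dotProduct_pow_succ_mulVec_le
    (h : IsResamplingBounded U ν τ) {m : ℕ} (hm : Even m) (i : ι) :
    ∫ t, t i * (U.row i ⬝ᵥ (weightedGram U t ^ (m + 1) *ᵥ U.row i)) ∂Measure.pi ν ≤
      ∫ t, (m + 1) / 2 * τ * ((t i + 2) * (U.row i ⬝ᵥ (weightedGram U t ^ m *ᵥ U.row i)))
        ∂Measure.pi ν := by
  classical
  by_cases hi : U.row i = 0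
  · simp only [hi, zero_dotProduct, mul_zero, le_refl]
  have hcont (m : ℕ) := continuous_dotProduct_weightedGram_pow_mulVec U m (U.row i)
  calc ∫ t, t i * (U.row i ⬝ᵥ (weightedGram U t ^ (m + 1) *ᵥ U.row i)) ∂Measure.pi ν
      ≤ ∫ t, (∫ c, (t i - c) ^ 2 ∂ν i) *
          ((m + 1) / 2 * (U.row i ⬝ᵥ U.row i) * (U.row i ⬝ᵥ (weightedGram U t ^ m *ᵥ U.row i)))
            ∂Measure.pi ν :=
        integral_mul_le_integral_sub_sq_mul h.exists_isCompact (h.integral_eq_zero i hi)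
          (hcont (m + 1)) (continuous_const.mul (hcont m)) fun t c =>
            mul_dotProduct_pow_succ_mulVec_sub_le (isHermitian_weightedGram U t)
              (isHermitian_weightedGram U _) (weightedGram_sub_update U t i c) hm
    _ ≤ ∫ t, (m + 1) / 2 * τ * ((t i + 2) * (U.row i ⬝ᵥ (weightedGram U t ^ m *ᵥ U.row i)))
          ∂Measure.pi ν := by
        refine integral_mono_ae (integrable_integral_sub_sq_mul h.exists_isCompact i (by fun_prop))
          (h.integrable_of_continuous (by fun_prop)) ?_
        filter_upwards [Measure.tendsto_eval_ae_ae.eventually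
          (h.ae_integral_sub_sq_mul_le i hi)] with t ht
        have hquad := dotProduct_even_pow_mulVec_nonneg (isHermitian_weightedGram U t) (U.row i) hm
        linear_combination
          mul_le_mul_of_nonneg_right ht (mul_nonneg (by positivity : (0 : ℝ) ≤ (m + 1) / 2) hquad)

theorem IsResamplingBounded.integral_trace_pow_add_two_le (h : IsResamplingBounded U ν τ)
    (hU : Uᵀ * U = 1) {m : ℕ} (hm : Even m) :
    ∫ t, (weightedGram U t ^ (m + 2)).trace ∂Measure.pi ν ≤
      (m + 1) / 2 * τ * (∫ t, (weightedGram U t ^ (m + 1)).trace ∂Measure.pi ν +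
        2 * ∫ t, (weightedGram U t ^ m).trace ∂Measure.pi ν) := by
  have hcont := fun i m => continuous_dotProduct_weightedGram_pow_mulVec U m (U.row i)
  have hcontTrace := continuous_trace_weightedGram_pow U
  have htrace (t : ι → ℝ) (j : ℕ) : (weightedGram U t ^ (j + 1)).trace =
      ∑ i, t i * (U.row i ⬝ᵥ (weightedGram U t ^ j *ᵥ U.row i)) := by
    rw [pow_succ', trace_weightedGram_mul]
  calc ∫ t, (weightedGram U t ^ (m + 2)).trace ∂Measure.pi ν
      = ∑ i, ∫ t, t i * (U.row i ⬝ᵥ (weightedGram U t ^ (m + 1) *ᵥ U.row i)) ∂Measure.pi ν := by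
        simp only [htrace _ (m + 1)]
        exact integral_finsetSum _ fun i _ => h.integrable_of_continuous (by fun_prop)
    _ ≤ ∑ i, ∫ t, (m + 1) / 2 * τ *
          ((t i + 2) * (U.row i ⬝ᵥ (weightedGram U t ^ m *ᵥ U.row i))) ∂Measure.pi ν :=
        sum_le_sum fun i _ => h.integral_mul_dotProduct_pow_succ_mulVec_le hm i
    _ = ∫ t, (m + 1) / 2 * τ * ∑ i, (t i + 2) * (U.row i ⬝ᵥ (weightedGram U t ^ m *ᵥ U.row i))
          ∂Measure.pi ν := by
        simp only [mul_sum]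
        exact (integral_finsetSum _ fun i _ => h.integrable_of_continuous (by fun_prop)).symm
    _ = ∫ t, (m + 1) / 2 * τ * ((weightedGram U t ^ (m + 1)).trace +
          2 * (weightedGram U t ^ m).trace) ∂Measure.pi ν := by
        simp only [add_mul, sum_add_distrib, ← mul_sum, sum_dotProduct_mulVec_eq_trace hU, htrace]
    _ = (m + 1) / 2 * τ * (∫ t, (weightedGram U t ^ (m + 1)).trace ∂Measure.pi ν +
          2 * ∫ t, (weightedGram U t ^ m).trace ∂Measure.pi ν) := by
        rw [integral_const_mul, integral_add (h.integrable_of_continuous (by fun_prop))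
          (h.integrable_of_continuous (by fun_prop)), integral_const_mul]

theorem IsResamplingBounded.integral_trace_pow_two_mul_succ_le (h : IsResamplingBounded U ν τ)
    (hU : Uᵀ * U = 1) (hτ : 0 ≤ τ) {s : ℕ} (hs : (s + 1) * τ ≤ 1) :
    ∫ t, (weightedGram U t ^ (2 * (s + 1))).trace ∂Measure.pi ν ≤
      5 * (s + 1) * τ * ∫ t, (weightedGram U t ^ (2 * s)).trace ∂Measure.pi ν := by
  have hev : Even (2 * s) := even_two_mul s
  set E : ℕ → ℝ := fun m => ∫ t, (weightedGram U t ^ m).trace ∂Measure.pi ν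
  have hint (m : ℕ) : Integrable (fun t => (weightedGram U t ^ m).trace) (Measure.pi ν) :=
    h.integrable_of_continuous (continuous_trace_weightedGram_pow U m)
  have hnonneg {m : ℕ} (hm : Even m) : 0 ≤ E m :=
    integral_nonneg fun t => trace_even_pow_nonneg (isHermitian_weightedGram U t) hm
  have hodd : E (2 * s + 1) ≤ (E (2 * s + 2) + E (2 * s)) / 2 := by
    rw [le_div_iff₀' two_pos]
    simp only [E]
    rw [← integral_const_mul, ← integral_add (hint _) (hint _)]
    exact integral_mono ((hint _).const_mul 2) ((hint _).add (hint _)) fun t =>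
      two_mul_trace_pow_succ_le (isHermitian_weightedGram U t) hev
  have hmean : 0 ≤ (E (2 * s + 2) + 5 * E (2 * s)) / 2 := by
    linarith [hnonneg (hev.add even_two), hnonneg hev]
  have hrec : E (2 * s + 2) ≤ (s + 1) * τ * ((E (2 * s + 2) + 5 * E (2 * s)) / 2) :=
    calc E (2 * s + 2) ≤ ((2 * s : ℕ) + 1) / 2 * τ * (E (2 * s + 1) + 2 * E (2 * s)) :=
          h.integral_trace_pow_add_two_le hU hev
      _ ≤ ((2 * s : ℕ) + 1) / 2 * τ * ((E (2 * s + 2) + 5 * E (2 * s)) / 2) := by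
          gcongr
          linarith
      _ ≤ (s + 1) * τ * ((E (2 * s + 2) + 5 * E (2 * s)) / 2) := by
          gcongr
          push_cast
          linarith
  have habsorb := mul_le_mul_of_nonneg_right hs (hnonneg (hev.add even_two))
  change E (2 * s + 2) ≤ 5 * (s + 1) * τ * E (2 * s)
  linear_combination 2 * hrec + habsorb

theorem IsResamplingBounded.integral_trace_pow_le (h : IsResamplingBounded U ν τ)
    (hU : Uᵀ * U = 1) (hτ : 0 ≤ τ) {s : ℕ} (hs : s * τ ≤ 1) :
    ∫ t, (weightedGram U t ^ (2 * s)).trace ∂Measure.pi ν ≤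
      (5 * s * τ) ^ s * Fintype.card r := by
  induction s with
  | zero => simp
  | succ s ih =>
    push_cast at hs ⊢
    calc ∫ t, (weightedGram U t ^ (2 * (s + 1))).trace ∂Measure.pi ν
        ≤ 5 * (s + 1) * τ * ∫ t, (weightedGram U t ^ (2 * s)).trace ∂Measure.pi ν :=
          h.integral_trace_pow_two_mul_succ_le hU hτ hs
      _ ≤ 5 * (s + 1) * τ * ((5 * s * τ) ^ s * Fintype.card r) := by
          gcongr
          exact ih (by linarith)
      _ ≤ 5 * (s + 1) * τ * ((5 * (s + 1) * τ) ^ s * Fintype.card r) := by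
          gcongr
          linarith
      _ = (5 * (s + 1) * τ) ^ (s + 1) * Fintype.card r := by ring

end Moments

section TwoPointLaw

/-- The law with mass `q` at `a` and mass `1 - q` at `b`. Both the law `entryLaw q` of an entry `s`
of the sampling matrix and that of the weight `s ^ 2 - 1` have this shape. -/
noncomputable def twoPointLaw (q a b : ℝ) : Measure ℝ :=
  ENNReal.ofReal q • Measure.dirac a + ENNReal.ofReal (1 - q) • Measure.dirac b

theorem map_twoPointLaw {f : ℝ → ℝ} (hf : Measurable f) (q a b : ℝ) :
    (twoPointLaw q a b).map f = twoPointLaw q (f a) (f b) := by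
  simp only [twoPointLaw, Measure.map_add _ _ hf, Measure.map_smul, Measure.map_dirac' hf]

variable {q : ℝ}

theorem isProbabilityMeasure_twoPointLaw (hq0 : 0 ≤ q) (hq1 : q ≤ 1) (a b : ℝ) :
    IsProbabilityMeasure (twoPointLaw q a b) := by
  constructor
  simp [twoPointLaw, ← ENNReal.ofReal_add hq0 (sub_nonneg.2 hq1)]

theorem integral_twoPointLaw (hq0 : 0 ≤ q) (hq1 : q ≤ 1) (a b : ℝ) (f : ℝ → ℝ) :
    ∫ x, f x ∂twoPointLaw q a b = q * f a + (1 - q) * f b := by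
  have hint (c y : ℝ) : Integrable f (ENNReal.ofReal c • Measure.dirac y) :=
    (integrable_dirac enorm_lt_top).smul_measure ENNReal.ofReal_ne_top
  rw [twoPointLaw, integral_add_measure (hint _ _) (hint _ _), integral_smul_measure,
    integral_smul_measure, integral_dirac, integral_dirac, ENNReal.toReal_ofReal hq0,
    ENNReal.toReal_ofReal (sub_nonneg.2 hq1), smul_eq_mul, smul_eq_mul]

theorem ae_twoPointLaw {p : ℝ → Prop} {a b : ℝ} (ha : p a) (hb : q ≠ 1 → p b) :
    ∀ᵐ x ∂twoPointLaw q a b, p x := by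
  rw [twoPointLaw, ae_add_measure_iff]
  refine ⟨Measure.ae_smul_measure (by simpa using ha) _, ?_⟩
  rcases eq_or_ne q 1 with rfl | hq
  · simp
  · exact Measure.ae_smul_measure (by simpa using hb hq) _

theorem map_sq_sub_one_entryLaw (hq0 : 0 ≤ q) :
    (entryLaw q).map (fun s => s ^ 2 - 1) = twoPointLaw q (1 / q - 1) (-1) := by
  have h := map_twoPointLaw (f := fun s => s ^ 2 - 1) (by fun_prop) q (1 / √q) 0
  rwa [div_pow, one_pow, Real.sq_sqrt hq0, zero_pow two_ne_zero, zero_sub] at h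

theorem isProbabilityMeasure_entryLaw (hq0 : 0 ≤ q) (hq1 : q ≤ 1) :
    IsProbabilityMeasure (entryLaw q) :=
  isProbabilityMeasure_twoPointLaw hq0 hq1 _ _

theorem isProbabilityMeasure_diagLaw {n : ℕ} {q : Fin n → ℝ} (hq0 : ∀ i, 0 ≤ q i)
    (hq1 : ∀ i, q i ≤ 1) : IsProbabilityMeasure (diagLaw q) := by
  have (i : Fin n) := isProbabilityMeasure_entryLaw (hq0 i) (hq1 i)
  unfold diagLaw
  infer_instance

theorem map_sq_sub_one_diagLaw {n : ℕ} {q : Fin n → ℝ} (hq0 : ∀ i, 0 ≤ q i) (hq1 : ∀ i, q i ≤ 1) :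
    (diagLaw q).map (fun s i => s i ^ 2 - 1) =
      Measure.pi fun i => twoPointLaw (q i) (1 / q i - 1) (-1) := by
  have (i : Fin n) := isProbabilityMeasure_entryLaw (hq0 i) (hq1 i)
  have hmeas (i : Fin n) : AEMeasurable (fun s : ℝ => s ^ 2 - 1) (entryLaw (q i)) := by fun_prop
  have (i : Fin n) := Measure.isProbabilityMeasure_map (hmeas i)
  simp only [← map_sq_sub_one_entryLaw (hq0 _)]
  exact Measure.pi_map_pi hmeas

theorem integral_twoPointLaw_inv_sub_one (hq0 : 0 < q) (hq1 : q ≤ 1) :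
    ∫ x, x ∂twoPointLaw q (1 / q - 1) (-1) = 0 := by
  rw [integral_twoPointLaw hq0.le hq1]
  field_simp
  ring

theorem ae_twoPointLaw_integral_sub_sq_mul_le (hq0 : 0 < q) (hq1 : q ≤ 1) {τ y : ℝ} (hτ : 0 ≤ τ)
    (hy : q = 1 ∨ y = q * τ) :
    ∀ᵐ x ∂twoPointLaw q (1 / q - 1) (-1),
      (∫ c, (x - c) ^ 2 ∂twoPointLaw q (1 / q - 1) (-1)) * y ≤ τ * (x + 2) := by
  simp only [integral_twoPointLaw hq0.le hq1]
  refine ae_twoPointLaw ?_ fun hq => ?_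
  · rcases hy with rfl | rfl
    · norm_num
      exact hτ
    · field_simp
      nlinarith
  · obtain rfl := hy.resolve_left hq
    field_simp
    linarith

end TwoPointLaw

section Sampling

variable {n d ρ : ℕ} {X : Matrix (Fin n) (Fin d) ℝ} {U : Matrix (Fin n) (Fin ρ) ℝ}

theorem norm_toLp_sq_eq_dotProduct {m : Type*} [Fintype m] (x : m → ℝ) :
    ‖WithLp.toLp 2 x‖ ^ 2 = x ⬝ᵥ x := by
  rw [EuclideanSpace.real_norm_sq_eq, dotProduct]
  exact sum_congr rfl fun i _ => sq (x i)

theorem IsOrthonormalColBasis.transpose_mul_self (h : IsOrthonormalColBasis X U) : Uᵀ * U = 1 := by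
  ext j k
  rw [one_apply, ← orthonormal_iff_ite.1 h.1 j k, EuclideanSpace.inner_toLp_toLp, star_trivial,
    dotProduct_comm]
  rfl

theorem IsOrthonormalColBasis.sum_norm_row_sq (h : IsOrthonormalColBasis X U) :
    ∑ i, ‖WithLp.toLp 2 (U.row i)‖ ^ 2 = ρ := by
  have htrace := sum_dotProduct_mulVec_eq_trace h.transpose_mul_self 1
  rw [trace_one, Fintype.card_fin] at htrace
  simpa only [norm_toLp_sq_eq_dotProduct, one_mulVec] using htrace

theorem IsOrthonormalColBasis.exists_mulVec_eq (h : IsOrthonormalColBasis X U) (γ : Fin d → ℝ) :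
    ∃ v, U *ᵥ v = X *ᵥ γ := by
  have hrange : LinearMap.range U.mulVecLin = LinearMap.range X.mulVecLin := by
    rw [range_mulVecLin, range_mulVecLin, h.2]
  exact hrange.ge ⟨γ, rfl⟩

theorem IsOrthonormalColBasis.isSubspaceEmbedding_diagonal (h : IsOrthonormalColBasis X U) {ε : ℝ}
    {s : Fin n → ℝ} (hs : ∀ v : Fin ρ → ℝ,
      |v ⬝ᵥ (weightedGram U (fun i => s i ^ 2 - 1) *ᵥ v)| ≤ ε * (v ⬝ᵥ v)) :
    IsSubspaceEmbedding ε X (diagonal s) := by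
  intro γ
  obtain ⟨v, hv⟩ := h.exists_mulVec_eq γ
  have hself : v ⬝ᵥ v = ∑ i, (U *ᵥ v) i ^ 2 := by
    simpa only [weightedGram_one, h.transpose_mul_self, one_mulVec, Pi.one_apply, one_mul] using
      dotProduct_weightedGram_mulVec U 1 v
  have hX : ‖WithLp.toLp 2 (X *ᵥ γ)‖ ^ 2 = v ⬝ᵥ v := by
    rw [← hv, EuclideanSpace.real_norm_sq_eq, hself]
  have hSX : ‖WithLp.toLp 2 ((diagonal s * X) *ᵥ γ)‖ ^ 2 =
      v ⬝ᵥ v + v ⬝ᵥ (weightedGram U (fun i => s i ^ 2 - 1) *ᵥ v) := by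
    rw [← mulVec_mulVec, ← hv, EuclideanSpace.real_norm_sq_eq, hself,
      dotProduct_weightedGram_mulVec, ← sum_add_distrib]
    refine sum_congr rfl fun i _ => ?_
    simp only [mulVec_diagonal]
    ring
  obtain ⟨hlower, hupper⟩ := abs_le.1 (hs v)
  rw [hX, hSX]
  constructor <;> linarith

theorem leverageScore_nonneg (U : Matrix (Fin n) (Fin ρ) ℝ) (i : Fin n) :
    0 ≤ leverageScore U i := by
  unfold leverageScore
  positivity

theorem samplingProb_nonneg (U : Matrix (Fin n) (Fin ρ) ℝ) {k : ℝ} (hk : 0 ≤ k) (i : Fin n) :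
    0 ≤ samplingProb U k i :=
  le_min zero_le_one (mul_nonneg hk (leverageScore_nonneg U i))

theorem samplingProb_le_one (U : Matrix (Fin n) (Fin ρ) ℝ) (k : ℝ) (i : Fin n) :
    samplingProb U k i ≤ 1 :=
  min_le_left _ _

theorem IsOrthonormalColBasis.samplingProb_eq (h : IsOrthonormalColBasis X U) (k : ℝ) (i : Fin n) :
    samplingProb U k i = min 1 (k / ρ * (U.row i ⬝ᵥ U.row i)) := by
  rw [samplingProb, leverageScore, h.sum_norm_row_sq, norm_toLp_sq_eq_dotProduct]
  ring_nf

theorem IsOrthonormalColBasis.samplingProb_pos (h : IsOrthonormalColBasis X U) (hρ : 0 < ρ) {k : ℝ}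
    (hk : 0 < k) {i : Fin n} (hi : U.row i ≠ 0) : 0 < samplingProb U k i := by
  have hrow : 0 < U.row i ⬝ᵥ U.row i := by
    rw [← norm_toLp_sq_eq_dotProduct]
    have : WithLp.toLp 2 (U.row i) ≠ 0 := by simpa using hi
    positivity
  rw [h.samplingProb_eq]
  positivity

theorem IsOrthonormalColBasis.samplingProb_eq_one_or (h : IsOrthonormalColBasis X U) (hρ : 0 < ρ)
    {k : ℝ} (hk : 0 < k) (i : Fin n) :
    samplingProb U k i = 1 ∨ U.row i ⬝ᵥ U.row i = samplingProb U k i * (ρ / k) := by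
  rw [h.samplingProb_eq]
  refine (min_choice 1 (k / ρ * (U.row i ⬝ᵥ U.row i))).imp_right fun hmin => ?_
  rw [hmin]
  field_simp

theorem IsOrthonormalColBasis.isResamplingBounded (h : IsOrthonormalColBasis X U) (hρ : 0 < ρ)
    {k : ℝ} (hk : 0 < k) :
    IsResamplingBounded U
      (fun i => twoPointLaw (samplingProb U k i) (1 / samplingProb U k i - 1) (-1)) (ρ / k) where
  exists_isCompact i := ⟨{1 / samplingProb U k i - 1, -1}, (Set.toFinite _).isCompact,
    ae_twoPointLaw (Set.mem_insert _ _) fun _ => Set.mem_insert_of_mem _ rfl⟩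
  integral_eq_zero i hi :=
    integral_twoPointLaw_inv_sub_one (h.samplingProb_pos hρ hk hi) (samplingProb_le_one U k i)
  ae_integral_sub_sq_mul_le i hi :=
    ae_twoPointLaw_integral_sub_sq_mul_le (h.samplingProb_pos hρ hk hi) (samplingProb_le_one U k i)
      (by positivity) (h.samplingProb_eq_one_or hρ hk i)

theorem one_sub_le_measureReal_of_integral_le {Ω : Type*} [MeasurableSpace Ω] {μ : Measure Ω}
    [IsProbabilityMeasure μ] {f : Ω → ℝ} (hf : Measurable f) (hf0 : ∀ ω, 0 ≤ f ω)
    (hfi : Integrable f μ) {a δ : ℝ} (ha : 0 < a) (hδ : ∫ ω, f ω ∂μ ≤ δ * a) :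
    1 - δ ≤ μ.real {ω | f ω ≤ a} := by
  have hmarkov := (mul_meas_ge_le_integral_of_nonneg (ae_of_all μ hf0) hfi a).trans hδ
  have hcompl : 1 - μ.real {ω | f ω ≤ a} ≤ μ.real {ω | a ≤ f ω} := by
    rw [← probReal_compl_eq_one_sub (measurableSet_le hf measurable_const)]
    exact measureReal_mono fun ω (hω : ¬f ω ≤ a) => (not_le.1 hω).le
  have := le_of_mul_le_mul_left (hmarkov.trans_eq (mul_comm δ a)) ha
  linarith

theorem IsOrthonormalColBasis.one_sub_le_diagLaw_real (h : IsOrthonormalColBasis X U) (hρ : 0 < ρ)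
    {k ε δ : ℝ} (hk : 0 < k) (hε : 0 < ε) {p : ℕ} (hp : p ≠ 0) (hpk : p * (ρ / k) ≤ 1)
    (hδ : (5 * p * (ρ / k)) ^ p * ρ ≤ δ * ε ^ (2 * p)) :
    1 - δ ≤ (diagLaw (samplingProb U k)).real {s | IsSubspaceEmbedding ε X (diagonal s)} := by
  have hq0 := samplingProb_nonneg U hk.le
  have hq1 := samplingProb_le_one U k
  have (i : Fin n) := isProbabilityMeasure_twoPointLaw (hq0 i) (hq1 i)
    (1 / samplingProb U k i - 1) (-1)
  have := isProbabilityMeasure_diagLaw hq0 hq1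
  have hbound := h.isResamplingBounded hρ hk
  have hcont := continuous_trace_weightedGram_pow U (2 * p)
  have hmoment := hbound.integral_trace_pow_le h.transpose_mul_self (by positivity) hpk
  have hgood : 1 - δ ≤ ((diagLaw (samplingProb U k)).map fun s i => s i ^ 2 - 1).real
      {t | (weightedGram U t ^ (2 * p)).trace ≤ ε ^ (2 * p)} := by
    rw [map_sq_sub_one_diagLaw hq0 hq1]
    refine one_sub_le_measureReal_of_integral_le hcont.measurable
      (fun t => trace_even_pow_nonneg (isHermitian_weightedGram U t) (even_two_mul p))
      (hbound.integrable_of_continuous hcont) (by positivity) (hmoment.trans ?_)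
    rwa [Fintype.card_fin]
  rw [map_measureReal_apply (by fun_prop) (measurableSet_le hcont.measurable measurable_const)]
    at hgood
  refine hgood.trans (measureReal_mono fun s hs => h.isSubspaceEmbedding_diagonal ?_)
  exact abs_dotProduct_mulVec_le_of_trace_pow_le (isHermitian_weightedGram U _) hp hε.le hs

theorem eq_zero_of_matrix_rank_eq_zero {m ι K : Type*} [Fintype ι] [Field K]
    {A : Matrix m ι K} (hA : A.rank = 0) : A = 0 := by
  classical
  have hrange : A.mulVecLin = 0 := LinearMap.range_eq_bot.1 (Submodule.finrank_eq_zero.1 hA)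
  exact ext_of_mulVec_single fun i => by
    rw [zero_mulVec]
    exact LinearMap.congr_fun hrange _

theorem isSubspaceEmbedding_zero {m : ℕ} (ε : ℝ) (S : Matrix (Fin m) (Fin n) ℝ) :
    IsSubspaceEmbedding ε (0 : Matrix (Fin n) (Fin d) ℝ) S := by
  simp [IsSubspaceEmbedding]

theorem one_third_pow_mul_le_one {x : ℝ} (hx : 0 < x) {p : ℕ} (hp : Real.log x ≤ p) :
    (1 / 3 : ℝ) ^ p * x ≤ 1 := by
  have hthird : (1 / 3 : ℝ) ≤ Real.exp (-1) := by
    rw [Real.exp_neg, one_div]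
    exact inv_anti₀ (Real.exp_pos 1) Real.exp_one_lt_three.le
  calc (1 / 3 : ℝ) ^ p * x ≤ Real.exp (-1) ^ p * Real.exp p := by
        gcongr
        exact (Real.log_le_iff_le_exp hx).1 hp
    _ = 1 := by rw [← Real.exp_nat_mul, ← Real.exp_add, mul_neg_one, neg_add_cancel, Real.exp_zero]

theorem IsOrthonormalColBasis.one_sub_le_diagLaw_real_of_log_le (h : IsOrthonormalColBasis X U)
    (hρ : 0 < ρ) {k ε δ : ℝ} (hδ : 0 < δ) (hε : 0 < ε) (hε1 : ε ≤ 1) {p : ℕ} (hp : p ≠ 0)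
    (hlog : Real.log (ρ / δ) ≤ p) (hk : 15 * p * ρ / ε ^ 2 ≤ k) :
    1 - δ ≤ (diagLaw (samplingProb U k)).real {s | IsSubspaceEmbedding ε X (diagonal s)} := by
  have hp0 : 0 < p := Nat.pos_of_ne_zero hp
  have hk0 : 0 < k := hk.trans_lt' (by positivity)
  have hratio : 5 * p * (ρ / k) ≤ ε ^ 2 * (1 / 3) := by
    rw [div_le_iff₀ (by positivity)] at hk
    rw [← mul_div_assoc, div_le_iff₀ hk0]
    linarith
  refine h.one_sub_le_diagLaw_real hρ hk0 hε hp ?_ ?_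
  · linarith [pow_le_one₀ (n := 2) hε.le hε1, show 0 ≤ p * (ρ / k) by positivity]
  · calc (5 * p * (ρ / k)) ^ p * ρ ≤ (ε ^ 2 * (1 / 3)) ^ p * ρ := by gcongr
      _ = δ * ε ^ (2 * p) * ((1 / 3) ^ p * (ρ / δ)) := by
        rw [mul_pow, ← pow_mul]
        field_simp
      _ ≤ δ * ε ^ (2 * p) :=
        mul_le_of_le_one_right (by positivity) (one_third_pow_mul_le_one (by positivity) hlog)

end Sampling

section SizeConstant

/-- The constant `D` of the sampling theorem. The logarithm `log (ρ / ε)` is bounded below by the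
minimum of `log 2` (if `2 ≤ ρ`) and `log (1 / ε₀)` (if `ρ = 1`), which lets it absorb
`log (1 / δ) + 1`. -/
noncomputable def sizeConstant (δ ε₀ : ℝ) : ℝ :=
  15 * (1 + (Real.log (1 / δ) + 1) / min (Real.log 2) (Real.log (1 / ε₀)))

variable {δ ε₀ ε : ℝ}

theorem min_log_two_log_one_div_pos (hε₀ : 0 < ε₀) (hε₀1 : ε₀ < 1) :
    0 < min (Real.log 2) (Real.log (1 / ε₀)) :=
  lt_min (Real.log_pos one_lt_two) (Real.log_pos ((one_lt_div hε₀).2 hε₀1))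

theorem sizeConstant_pos (hδ : 0 < δ) (hδ1 : δ ≤ 1) (hε₀ : 0 < ε₀) (hε₀1 : ε₀ < 1) :
    0 < sizeConstant δ ε₀ := by
  have hlog := Real.log_nonneg ((one_le_div hδ).2 hδ1)
  have hmin := min_log_two_log_one_div_pos hε₀ hε₀1
  unfold sizeConstant
  positivity

variable {ρ : ℕ}

theorem log_le_log_div (hρ : 0 < ρ) (hε : 0 < ε) (hε1 : ε ≤ 1) :
    Real.log ρ ≤ Real.log (ρ / ε) :=
  Real.log_le_log (by positivity) (le_div_self (by positivity) hε hε1)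

theorem min_log_two_log_one_div_le_log_div (hρ : 0 < ρ) (hε : 0 < ε) (hε1 : ε ≤ 1)
    (hερ : ρ = 1 → ε ≤ ε₀) (hε₀ : 0 < ε₀) :
    min (Real.log 2) (Real.log (1 / ε₀)) ≤ Real.log (ρ / ε) := by
  rcases (Nat.succ_le_of_lt hρ).eq_or_lt with rfl | h2
  · rw [Nat.cast_one]
    exact (min_le_right _ _).trans
      (Real.log_le_log (by positivity) (one_div_le_one_div_of_le hε (hερ rfl)))
  · have h2 : (2 : ℝ) ≤ ρ := by exact_mod_cast h2
    exact (min_le_left _ _).trans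
      ((Real.log_le_log two_pos h2).trans (log_le_log_div hρ hε hε1))

theorem fifteen_mul_ceil_log_div_le (hδ : 0 < δ) (hδ1 : δ ≤ 1) (hε₀ : 0 < ε₀) (hε₀1 : ε₀ < 1)
    (hρ : 0 < ρ) (hε : 0 < ε) (hε1 : ε ≤ 1) (hερ : ρ = 1 → ε ≤ ε₀) :
    15 * (⌈Real.log (ρ / δ)⌉₊ : ℝ) ≤ sizeConstant δ ε₀ * Real.log (ρ / ε) := by
  set L := min (Real.log 2) (Real.log (1 / ε₀))
  have hL : 0 < L := min_log_two_log_one_div_pos hε₀ hε₀1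
  have hLle : L ≤ Real.log (ρ / ε) := min_log_two_log_one_div_le_log_div hρ hε hε1 hερ hε₀
  have hlogδ : 0 ≤ Real.log (1 / δ) := Real.log_nonneg ((one_le_div hδ).2 hδ1)
  have hlogρ : 0 ≤ Real.log ρ := Real.log_natCast_nonneg ρ
  have hsplit : Real.log (ρ / δ) = Real.log ρ + Real.log (1 / δ) := by
    rw [← Real.log_mul (by positivity) (by positivity), mul_one_div]
  have hceil : (⌈Real.log (ρ / δ)⌉₊ : ℝ) ≤ Real.log ρ + (Real.log (1 / δ) + 1) := by
    linarith [Nat.ceil_lt_add_one (hsplit ▸ add_nonneg hlogρ hlogδ)]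
  calc 15 * (⌈Real.log (ρ / δ)⌉₊ : ℝ)
      ≤ 15 * (Real.log ρ + (Real.log (1 / δ) + 1) / L * L) := by
        rw [div_mul_cancel₀ _ hL.ne']
        gcongr
    _ ≤ 15 * (Real.log (ρ / ε) + (Real.log (1 / δ) + 1) / L * Real.log (ρ / ε)) := by
        gcongr 15 * (?_ + _ * ?_)
        exact log_le_log_div hρ hε hε1
    _ = sizeConstant δ ε₀ * Real.log (ρ / ε) := by
        rw [sizeConstant]
        ring

end SizeConstant

end LeverageSampling

/-- For every failure probability `δ` there is a constant `D` such that leverage-score sampling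
with size parameter `k ≥ D ρ log (ρ / ε) / ε ^ 2` gives an `ε`-subspace embedding with probability
at least `1 - δ`. Where `ρ = 1`, the accuracy `ε` has to stay below some `ε₀ < 1`, because
`log (ρ / ε)` tends to `0` as `ε` tends to `1`. -/
theorem mainTheorem3 (δ ε₀ : ℝ) (hδ : 0 < δ) (hδ1 : δ < 1) (hε₀ : 0 < ε₀) (hε₀1 : ε₀ < 1) :
    ∃ D : ℝ, 0 < D ∧
      ∀ (n d ρ : ℕ) (X : Matrix (Fin n) (Fin d) ℝ) (U : Matrix (Fin n) (Fin ρ) ℝ) (ε k : ℝ),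
        X.rank = ρ →
        LeverageSampling.IsOrthonormalColBasis X U →
        0 < ε → ε < 1 → (ρ = 1 → ε ≤ ε₀) →
        D * ((ρ : ℝ) * Real.log ((ρ : ℝ) / ε) / ε ^ 2) ≤ k →
        1 - δ ≤ (LeverageSampling.diagLaw (LeverageSampling.samplingProb U k)).real
          {s : Fin n → ℝ | LeverageSampling.IsSubspaceEmbedding ε X (Matrix.diagonal s)} := by
  refine ⟨LeverageSampling.sizeConstant δ ε₀,
    LeverageSampling.sizeConstant_pos hδ hδ1.le hε₀ hε₀1,
    fun n d ρ X U ε k hX hU hε hε1 hερ hk => ?_⟩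
  rcases Nat.eq_zero_or_pos ρ with rfl | hρ
  · obtain rfl := LeverageSampling.eq_zero_of_matrix_rank_eq_zero hX
    have := LeverageSampling.isProbabilityMeasure_diagLaw
      (LeverageSampling.samplingProb_nonneg U (by simpa using hk))
      (LeverageSampling.samplingProb_le_one U k)
    simpa [LeverageSampling.isSubspaceEmbedding_zero] using hδ.le
  have hρ1 : (1 : ℝ) ≤ ρ := by exact_mod_cast hρ
  have hceil : ⌈Real.log (ρ / δ)⌉₊ ≠ 0 :=
    (Nat.ceil_pos.2 (Real.log_pos ((one_lt_div hδ).2 (hδ1.trans_le hρ1)))).ne'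
  refine hU.one_sub_le_diagLaw_real_of_log_le hρ hδ hε hε1.le hceil (Nat.le_ceil _) (hk.trans' ?_)
  calc 15 * (⌈Real.log (ρ / δ)⌉₊ : ℝ) * ρ / ε ^ 2
      ≤ LeverageSampling.sizeConstant δ ε₀ * Real.log (ρ / ε) * ρ / ε ^ 2 := by
        gcongr ?_ * ρ / ε ^ 2
        exact LeverageSampling.fifteen_mul_ceil_log_div_le hδ hδ1.le hε₀ hε₀1 hρ hε hε1.le hερ
    _ = LeverageSampling.sizeConstant δ ε₀ * (ρ * Real.log (ρ / ε) / ε ^ 2) := by ring
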